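/- Let $K$ be a field and $R=K[x_1,\dots,x_n]$ the standard graded polynomial ring. For a homogeneous ideal $I\subseteq R$ let $$0\to F_p\to\cdots\to F_1\to F_0\to R/I\to 0,\qquad F_i=\bigoplus_j R(-j)^{b_{ij}},$$ be the minimal graded free resolution of $R/I$, and put $t_i(R/I)=\sup\{j : b_{ij}\neq 0\}$ (with $t_i(R/I)=-\infty$ if $F_i=0$). We say that subadditivity holds for $R/I$ if $t_{a+b}(R/I)\le t_a(R/I)+t_b(R/I)$ for all $a,b\ge 0$ with $a+b\le p$. (1) Let $I\subseteq R$ be a homogeneous ideal and $f\in R$ a homogeneous polynomial of degree $d>0$ such that $I:f=I$. If subadditivity holds for $R/I$, then subadditivity holds for $R/(I,f)$. (2) Consequently, if $I$ is a homogeneous complete intersection, that is, if $I$ is generated by an $R$-regular sequence of homogeneous polynomials, then subadditivity holds for $R/I$. -/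

import Mathlib

namespace GradedRes

open MvPolynomial

/-- The degree `j` part, `j : ℤ`, of the standard graded polynomial ring `K[x_1, …, x_n]`;
it is zero in negative degrees. -/
noncomputable def polyPart (K : Type*) [Field K] (n : ℕ) (j : ℤ) :
    Submodule K (MvPolynomial (Fin n) K) :=
  if 0 ≤ j then homogeneousSubmodule (Fin n) K j.toNat else ⊥

/-- The degree `j` part of the graded free module `⨁ k, R(-s k)`: the vectors whose `k`-th
coordinate is a homogeneous polynomial of degree `j - s k`. -/
noncomputable def freePart (K : Type*) [Field K] (n : ℕ) {r : ℕ} (s : Fin r → ℤ) (j : ℤ) :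
    Submodule K (Fin r → MvPolynomial (Fin n) K) :=
  Submodule.pi Set.univ fun k => polyPart K n (j - s k)

/-- The degree `j` part of `R / I`, the image of the degree `j` part of `R`. -/
noncomputable def quotientPart {K : Type*} [Field K] {n : ℕ} (I : Ideal (MvPolynomial (Fin n) K))
    (j : ℤ) : Submodule K (MvPolynomial (Fin n) K ⧸ I) :=
  (polyPart K n j).map (Ideal.Quotient.mkₐ K I).toLinearMap

/-- A finite graded free resolution `0 → F_p → ⋯ → F_1 → F_0 → M → 0` over `R = K[x_1, …, x_n]`
of a module `M` whose degree `j` part is `𝓜 j`. Here `p = length`,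
`F_i = ⨁ k : Fin (rank i), R(-shift i k)`, and all the maps are homogeneous of degree zero. -/
structure GradedFreeResolution {K : Type*} [Field K] {n : ℕ} (M : Type*) [AddCommGroup M]
    [Module K M] [Module (MvPolynomial (Fin n) K) M] (𝓜 : ℤ → Submodule K M) where
  length : ℕ
  rank : ℕ → ℕ
  rank_eq_zero : ∀ i, length < i → rank i = 0
  shift : ∀ i, Fin (rank i) → ℤ
  d : ∀ i, (Fin (rank (i + 1)) → MvPolynomial (Fin n) K) →ₗ[MvPolynomial (Fin n) K]
    (Fin (rank i) → MvPolynomial (Fin n) K)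
  ε : (Fin (rank 0) → MvPolynomial (Fin n) K) →ₗ[MvPolynomial (Fin n) K] M
  d_mem : ∀ i j, ∀ v ∈ freePart K n (shift (i + 1)) j, d i v ∈ freePart K n (shift i) j
  ε_mem : ∀ j, ∀ v ∈ freePart K n (shift 0) j, ε v ∈ 𝓜 j
  ε_surjective : Function.Surjective ε
  exact_zero : Function.Exact (d 0) ε
  exact_succ : ∀ i, Function.Exact (d (i + 1)) (d i)

namespace GradedFreeResolution

variable {K : Type*} [Field K] {n : ℕ} {M : Type*} [AddCommGroup M]
  [Module K M] [Module (MvPolynomial (Fin n) K) M] {𝓜 : ℤ → Submodule K M}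

/-- The number `b_{i,j}` of summands `R(-j)` of `F_i`. -/
def betti (F : GradedFreeResolution (n := n) M 𝓜) (i : ℕ) (j : ℤ) : ℕ :=
  (Finset.univ.filter fun k => F.shift i k = j).card

/-- The maximal shift `t_i(F) = sup {j : b_{i,j} ≠ 0}`, with `t_i(F) = -∞` (that is, `⊥`) if
`F_i = 0`. -/
def maxShift (F : GradedFreeResolution (n := n) M 𝓜) (i : ℕ) : WithBot ℤ :=
  Finset.univ.sup fun k => (F.shift i k : WithBot ℤ)

/-- `maxShift F i` is the supremum of the `j` with `b_{i,j} ≠ 0`. -/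
theorem isLUB_maxShift (F : GradedFreeResolution (n := n) M 𝓜) (i : ℕ) :
    IsLUB {x : WithBot ℤ | ∃ j : ℤ, F.betti i j ≠ 0 ∧ x = j} (F.maxShift i) := by
  constructor
  · rintro x ⟨j, hj, rfl⟩
    obtain ⟨k, hk⟩ := Finset.card_ne_zero.mp hj
    rw [← (Finset.mem_filter.mp hk).2]
    exact Finset.le_sup (f := fun k => (F.shift i k : WithBot ℤ)) (Finset.mem_univ k)
  · intro y hy
    refine Finset.sup_le fun k _ => hy ⟨F.shift i k, ?_, rfl⟩
    exact Finset.card_ne_zero.mpr ⟨k, by simp⟩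

/-- Minimality: the image of each `F_{i+1} → F_i` lies in `(x_1, …, x_n) F_i`. -/
def IsMinimal (F : GradedFreeResolution (n := n) M 𝓜) : Prop :=
  ∀ i v k, constantCoeff (F.d i v k) = 0

/-- Subadditivity of a resolution: `t_{a+b} ≤ t_a + t_b` whenever `a + b ≤ p`. If `p` exceeds the
last index with `F_i ≠ 0`, the extra inequalities hold because their left side is `-∞`. -/
def Subadditive (F : GradedFreeResolution (n := n) M 𝓜) : Prop :=
  ∀ a b : ℕ, a + b ≤ F.length → F.maxShift (a + b) ≤ F.maxShift a + F.maxShift b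

end GradedFreeResolution

/-- Subadditivity holds for `R / I`: its minimal graded free resolution, which is unique up to
isomorphism of graded complexes, satisfies subadditivity. -/
def SubadditivityHolds {K : Type*} [Field K] {n : ℕ} (I : Ideal (MvPolynomial (Fin n) K)) :
    Prop :=
  ∃ F : GradedFreeResolution (n := n) (MvPolynomial (Fin n) K ⧸ I) (quotientPart I),
    F.IsMinimal ∧ F.Subadditive

/-- `I` is a homogeneous complete intersection: it is generated by a (possibly empty) regular
sequence of homogeneous polynomials. -/
def IsHomogeneousCompleteIntersection {K : Type*} [Field K] {n : ℕ}
    (I : Ideal (MvPolynomial (Fin n) K)) : Prop :=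
  ∃ rs : List (MvPolynomial (Fin n) K), (∀ g ∈ rs, ∃ e : ℕ, g.IsHomogeneous e) ∧
    RingTheory.Sequence.IsRegular (MvPolynomial (Fin n) K) rs ∧ I = Ideal.ofList rs

end GradedRes

attribute [local instance] MvPolynomial.gradedAlgebra

/-! If `f` is regular on `R/I` and `F` resolves `R/I`, the mapping cone of `f : F(-d) → F` resolves
`R/(I, f)`. It stays minimal because `d > 0` puts `f` in the maximal ideal. Its maximal shifts are
`T_0 = t_0` and `T_{i+1} = max(t_{i+1}, t_i + d)`, so subadditivity of `T` follows from that of `t`: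
a bound on `t_{a+b}` passes to `T` since `t ≤ T`, and in a bound on `t_{a+b-1} + d` the `d` is
absorbed by raising one index by one. The carriers are `exact_coneD_coneD`, `maxShift_cone_succ` and
`Subadditive.cone`. Complete intersections follow by adjoining generators one at a time to the zero
ideal. -/

namespace GradedRes

open MvPolynomial

/-! ### Homogeneous components -/

section Degree

variable {K : Type*} [Field K] {n : ℕ}

theorem mem_freePart {r : ℕ} {s : Fin r → ℤ} {j : ℤ} {v : Fin r → MvPolynomial (Fin n) K} :
    v ∈ freePart K n s j ↔ ∀ k, v k ∈ polyPart K n (j - s k) := by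
  simp [freePart, Submodule.mem_pi]

theorem mul_mem_polyPart {f g : MvPolynomial (Fin n) K} {d : ℕ} (hf : f.IsHomogeneous d) {j : ℤ}
    (hg : g ∈ polyPart K n (j - d)) : f * g ∈ polyPart K n j := by
  unfold polyPart at hg ⊢
  split_ifs at hg with h
  · rw [if_pos (by omega)]
    have hj : j.toNat = d + (j - d).toNat := by omega
    rw [hj]
    exact hf.mul hg
  · rw [(Submodule.mem_bot K).mp hg, mul_zero]
    exact Submodule.zero_mem _

theorem constantCoeff_eq_zero_of_isHomogeneous {f : MvPolynomial (Fin n) K} {d : ℕ}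
    (hf : f.IsHomogeneous d) (hd : 0 < d) : constantCoeff f = 0 := by
  rw [constantCoeff_eq]
  exact hf.coeff_eq_zero (by simpa using hd.ne)

end Degree

namespace GradedFreeResolution

variable {K : Type*} [Field K] {n : ℕ}

/-- The free resolution `0 → R → R / 0 → 0`. -/
noncomputable def ofBot :
    GradedFreeResolution (n := n) (MvPolynomial (Fin n) K ⧸ (⊥ : Ideal (MvPolynomial (Fin n) K)))
      (quotientPart ⊥) where
  length := 0
  rank i := if i = 0 then 1 else 0
  rank_eq_zero i hi := if_neg hi.ne'
  shift _ _ := 0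
  d _ := 0
  ε := (Submodule.mkQ ⊥).comp (LinearMap.proj ⟨0, Nat.one_pos⟩)
  d_mem _ _ _ _ := Submodule.zero_mem _
  ε_mem j v hv := by
    refine ⟨_, ?_, rfl⟩
    simpa using mem_freePart.mp hv ⟨0, by simp⟩
  ε_surjective := (Submodule.mkQ_surjective _).comp fun x => ⟨fun _ => x, rfl⟩
  exact_zero v := by
    have h1 : ∀ k : Fin (if (0 : ℕ) = 0 then 1 else 0), k = ⟨0, by simp⟩ := by
      rintro ⟨k, hk⟩
      simp at hk
      simpa using hk
    constructor
    · intro h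
      have h0 : v ⟨0, by simp⟩ = 0 := by
        exact (Submodule.Quotient.mk_eq_zero _).mp h
      refine ⟨0, ?_⟩
      ext1 k
      rw [h1 k, h0]
      rfl
    · rintro ⟨w, rfl⟩
      simp
  exact_succ i v := by
    have : IsEmpty (Fin (if i + 1 = 0 then 1 else 0)) := by
      rw [if_neg (Nat.succ_ne_zero i)]
      infer_instance
    exact ⟨fun _ => ⟨0, Subsingleton.elim _ _⟩, fun _ => rfl⟩

theorem ofBot_isMinimal : (ofBot (K := K) (n := n)).IsMinimal := fun _ _ _ =>
  map_zero constantCoeff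

theorem ofBot_subadditive : (ofBot (K := K) (n := n)).Subadditive := by
  intro a b h
  have h' : a + b ≤ 0 := h
  obtain ⟨rfl, rfl⟩ : a = 0 ∧ b = 0 := by omega
  have h0 : (ofBot (K := K) (n := n)).maxShift 0 = 0 :=
    (Finset.sup_const (s := (Finset.univ : Finset (Fin 1))) Finset.univ_nonempty (0 : WithBot ℤ))
  simp [h0]

/-! ### The mapping cone of multiplication by a homogeneous polynomial -/

section Cone

variable {I : Ideal (MvPolynomial (Fin n) K)}

/-- The ranks of the mapping cone of `f : F(-d) → F`. -/
def coneRank (r : ℕ → ℕ) : ℕ → ℕ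
  | 0 => r 0
  | i + 1 => r (i + 1) + r i

variable (F : GradedFreeResolution (n := n) (MvPolynomial (Fin n) K ⧸ I) (quotientPart I))

/-- The shifts of the mapping cone of `f : F(-d) → F`. -/
def coneShift (d : ℕ) : ∀ i, Fin (coneRank F.rank i) → ℤ
  | 0 => F.shift 0
  | i + 1 => Fin.append (F.shift (i + 1)) fun k => F.shift i k + d

/-- The projection of `R^(a+b)` to `R^a`. -/
def fstMap (R : Type*) [CommRing R] (a b : ℕ) : (Fin (a + b) → R) →ₗ[R] (Fin a → R) :=
  LinearMap.funLeft R R (Fin.castAdd b)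

/-- The projection of `R^(a+b)` to `R^b`. -/
def sndMap (R : Type*) [CommRing R] (a b : ℕ) : (Fin (a + b) → R) →ₗ[R] (Fin b → R) :=
  LinearMap.funLeft R R (Fin.natAdd a)

/-- The linear map to `R^(a+b)` with given components. -/
def pairMap {R M : Type*} [CommRing R] [AddCommGroup M] [Module R M] {a b : ℕ}
    (g : M →ₗ[R] (Fin a → R)) (h : M →ₗ[R] (Fin b → R)) : M →ₗ[R] (Fin (a + b) → R) where
  toFun m := Fin.append (g m) (h m)
  map_add' x y := by
    ext k
    refine Fin.addCases (fun k => ?_) (fun k => ?_) k <;> simp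
  map_smul' c x := by
    ext k
    refine Fin.addCases (fun k => ?_) (fun k => ?_) k <;> simp

/-- The differential of the mapping cone of `f : F(-d) → F`. -/
noncomputable def coneD (f : MvPolynomial (Fin n) K) :
    ∀ i, (Fin (coneRank F.rank (i + 1)) → MvPolynomial (Fin n) K) →ₗ[MvPolynomial (Fin n) K]
      (Fin (coneRank F.rank i) → MvPolynomial (Fin n) K)
  | 0 => (F.d 0).comp (fstMap _ _ _) + f • sndMap _ (F.rank 1) (F.rank 0)
  | i + 1 => pairMap
      ((F.d (i + 1)).comp (fstMap _ _ _) + f • sndMap _ (F.rank (i + 2)) (F.rank (i + 1)))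
      (-((F.d i).comp (sndMap _ (F.rank (i + 2)) (F.rank (i + 1)))))

theorem coneD_zero_append (f : MvPolynomial (Fin n) K) (x y) :
    F.coneD f 0 (Fin.append x y) = F.d 0 x + f • y := by
  have h1 : fstMap _ _ _ (Fin.append x y) = x := by ext1 k; simp [fstMap, LinearMap.funLeft]
  have h2 : sndMap _ _ _ (Fin.append x y) = y := by ext1 k; simp [sndMap, LinearMap.funLeft]
  change F.d 0 (fstMap _ _ _ (Fin.append x y)) + f • sndMap _ _ _ (Fin.append x y) = _
  rw [h1, h2]

theorem coneD_succ_append (f : MvPolynomial (Fin n) K) (i : ℕ) (x y) :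
    F.coneD f (i + 1) (Fin.append x y) = Fin.append (F.d (i + 1) x + f • y) (-F.d i y) := by
  have h1 : fstMap _ _ _ (Fin.append x y) = x := by ext1 k; simp [fstMap, LinearMap.funLeft]
  have h2 : sndMap _ _ _ (Fin.append x y) = y := by ext1 k; simp [sndMap, LinearMap.funLeft]
  change Fin.append (F.d (i + 1) (fstMap _ _ _ (Fin.append x y))
    + f • sndMap _ _ _ (Fin.append x y)) (-F.d i (sndMap _ _ _ (Fin.append x y))) = _
  rw [h1, h2]

theorem exists_eq_append {R : Type*} {a b : ℕ} (v : Fin (a + b) → R) :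
    ∃ x y, v = Fin.append x y :=
  ⟨fun k => v (Fin.castAdd b k), fun k => v (Fin.natAdd a k), (Fin.append_castAdd_natAdd).symm⟩

theorem append_eq_append_iff {R : Type*} {a b : ℕ} {x x' : Fin a → R} {y y' : Fin b → R} :
    Fin.append x y = Fin.append x' y' ↔ x = x' ∧ y = y' := by
  refine ⟨fun h => ⟨?_, ?_⟩, by rintro ⟨rfl, rfl⟩; rfl⟩
  · ext1 k; simpa using congrFun h (Fin.castAdd b k)
  · ext1 k; simpa using congrFun h (Fin.natAdd a k)

theorem append_zero_zero {R : Type*} [Zero R] {a b : ℕ} :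
    Fin.append (0 : Fin a → R) (0 : Fin b → R) = 0 := by
  ext k
  refine Fin.addCases (fun k => ?_) (fun k => ?_) k <;> simp

theorem append_mem_freePart {a b : ℕ} {s : Fin a → ℤ} {t : Fin b → ℤ} {j : ℤ}
    {x : Fin a → MvPolynomial (Fin n) K} {y : Fin b → MvPolynomial (Fin n) K} :
    Fin.append x y ∈ freePart K n (Fin.append s t) j ↔
      x ∈ freePart K n s j ∧ y ∈ freePart K n t j := by
  simp only [mem_freePart]
  refine ⟨fun h => ⟨fun k => ?_, fun k => ?_⟩, fun h k => ?_⟩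
  · simpa using h (Fin.castAdd b k)
  · simpa using h (Fin.natAdd a k)
  · refine Fin.addCases (fun k => ?_) (fun k => ?_) k
    · simpa using h.1 k
    · simpa using h.2 k

theorem mem_freePart_add {r : ℕ} {s : Fin r → ℤ} {d j : ℤ}
    {y : Fin r → MvPolynomial (Fin n) K} :
    y ∈ freePart K n (fun k => s k + d) j ↔ y ∈ freePart K n s (j - d) := by
  simp only [mem_freePart, sub_sub, add_comm d]

theorem smul_mem_freePart {r : ℕ} {s : Fin r → ℤ} {d : ℕ} {j : ℤ} {f : MvPolynomial (Fin n) K}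
    (hf : f.IsHomogeneous d) {y : Fin r → MvPolynomial (Fin n) K}
    (hy : y ∈ freePart K n s (j - d)) : f • y ∈ freePart K n s j := by
  rw [mem_freePart] at hy ⊢
  intro k
  refine mul_mem_polyPart hf ?_
  rw [sub_right_comm]
  exact hy k

theorem d_d (i : ℕ) (x) : F.d i (F.d (i + 1) x) = 0 := (F.exact_succ i _).mpr ⟨x, rfl⟩

theorem ε_d (x) : F.ε (F.d 0 x) = 0 := (F.exact_zero _).mpr ⟨x, rfl⟩

/-- The augmentation of the mapping cone of `f : F(-d) → F`. -/
noncomputable def coneε (f : MvPolynomial (Fin n) K) :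
    (Fin (F.rank 0) → MvPolynomial (Fin n) K) →ₗ[MvPolynomial (Fin n) K]
      MvPolynomial (Fin n) K ⧸ (I ⊔ Ideal.span {f}) :=
  (Submodule.factor (le_sup_left : I ≤ I ⊔ Ideal.span {f})).comp F.ε

theorem coneε_eq_mk {f p : MvPolynomial (Fin n) K} {v : Fin (F.rank 0) → MvPolynomial (Fin n) K}
    (h : Submodule.mkQ I p = F.ε v) :
    F.coneε f v = Submodule.mkQ (I ⊔ Ideal.span {f}) p := by
  change Submodule.factor (le_sup_left : I ≤ I ⊔ Ideal.span {f}) (F.ε v) = _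
  rw [← h]
  rfl

theorem coneε_eq_zero_iff {f : MvPolynomial (Fin n) K}
    {v : Fin (F.rank 0) → MvPolynomial (Fin n) K} :
    F.coneε f v = 0 ↔ ∃ x y, F.d 0 x + f • y = v := by
  constructor
  · intro h
    obtain ⟨p, hp⟩ := Submodule.mkQ_surjective I (F.ε v)
    have hp' : p ∈ I ⊔ Ideal.span {f} :=
      (Submodule.Quotient.mk_eq_zero _).mp ((F.coneε_eq_mk hp).symm.trans h)
    obtain ⟨q, hq, g, hg, rfl⟩ := Submodule.mem_sup.mp hp'
    obtain ⟨c, rfl⟩ := Ideal.mem_span_singleton'.mp hg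
    -- Lifting the coefficient `c` of `f` to `F_0` lets `f • y` cancel the part of `v` outside `ker
    -- ε`.
    obtain ⟨y, hy⟩ := F.ε_surjective (Submodule.mkQ I c)
    have hv : F.ε (v - f • y) = 0 := by
      rw [map_sub, map_smul, hy, ← hp, ← map_smul, ← map_sub]
      refine (Submodule.Quotient.mk_eq_zero _).mpr ?_
      have : q + c * f - f • c = q := by rw [smul_eq_mul]; ring
      rwa [this]
    obtain ⟨x, hx⟩ := (F.exact_zero _).mp hv
    exact ⟨x, y, by rw [hx, sub_add_cancel]⟩
  · rintro ⟨x, y, rfl⟩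
    obtain ⟨p, hp⟩ := Submodule.mkQ_surjective I (F.ε y)
    have h : Submodule.mkQ I (f • p) = F.ε (F.d 0 x + f • y) := by
      rw [map_add, ε_d, zero_add, map_smul, map_smul, hp]
    rw [F.coneε_eq_mk h]
    exact (Submodule.Quotient.mk_eq_zero _).mpr
      (Ideal.mul_mem_right _ _ (Ideal.mem_sup_right (Ideal.mem_span_singleton_self f)))

theorem exact_coneD_coneε (f : MvPolynomial (Fin n) K) :
    Function.Exact (F.coneD f 0) (F.coneε f) := by
  intro v
  refine F.coneε_eq_zero_iff.trans ⟨?_, ?_⟩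
  · rintro ⟨x, y, rfl⟩
    exact ⟨Fin.append x y, F.coneD_zero_append f x y⟩
  · rintro ⟨w, rfl⟩
    obtain ⟨x, y, rfl⟩ := exists_eq_append w
    exact ⟨x, y, (F.coneD_zero_append f x y).symm⟩

/-- Regularity of `f` is needed only for `i = 0`: there `d x + f y = 0` gives `f · ε y = 0`, hence
`ε y = 0`. For larger `i` the second coordinate already says `d y = 0`. -/
theorem coneD_append_eq_zero_iff {f : MvPolynomial (Fin n) K}
    (hreg : IsSMulRegular (MvPolynomial (Fin n) K ⧸ I) f) (i : ℕ) (x y) :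
    F.coneD f i (Fin.append x y) = 0 ↔ F.d i x + f • y = 0 ∧ ∃ z, F.d i z = y := by
  cases i with
  | zero =>
    rw [coneD_zero_append]
    refine ⟨fun h => ⟨h, (F.exact_zero y).mp (hreg ?_)⟩, fun h => h.1⟩
    have h' : F.ε (F.d 0 x + f • y) = 0 := (congrArg F.ε h).trans (map_zero F.ε)
    rw [map_add, ε_d, zero_add, map_smul] at h'
    exact h'.trans (smul_zero f).symm
  | succ i =>
    rw [coneD_succ_append]
    constructor
    · intro h
      obtain ⟨h1, h2⟩ := append_eq_append_iff.mp (h.trans append_zero_zero.symm)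
      exact ⟨h1, (F.exact_succ i y).mp (neg_eq_zero.mp h2)⟩
    · rintro ⟨h1, h2⟩
      rw [h1, (F.exact_succ i y).mpr h2, neg_zero]
      exact append_zero_zero

theorem exact_coneD_coneD {f : MvPolynomial (Fin n) K}
    (hreg : IsSMulRegular (MvPolynomial (Fin n) K ⧸ I) f) (i : ℕ) :
    Function.Exact (F.coneD f (i + 1)) (F.coneD f i) := by
  intro v
  obtain ⟨x, y, rfl⟩ := exists_eq_append v
  refine (F.coneD_append_eq_zero_iff hreg i x y).trans ⟨?_, ?_⟩
  · rintro ⟨h, z, rfl⟩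
    rw [← map_smul, ← map_add] at h
    obtain ⟨u, hu⟩ := (F.exact_succ i _).mp h
    -- Here `y = d z` and `d u = x + f z`; the sign of `z` offsets the sign in the second component
    -- of `coneD`.
    refine ⟨Fin.append u (-z), ?_⟩
    rw [coneD_succ_append, hu, smul_neg, map_neg, neg_neg, add_neg_cancel_right]
  · rintro ⟨w, hw⟩
    obtain ⟨z, u, rfl⟩ := exists_eq_append w
    rw [coneD_succ_append] at hw
    obtain ⟨rfl, rfl⟩ := append_eq_append_iff.mp hw
    refine ⟨?_, -u, map_neg _ _⟩
    rw [map_add, d_d, map_smul, zero_add, smul_neg, add_neg_cancel]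

theorem coneD_mem {f : MvPolynomial (Fin n) K} {d : ℕ} (hf : f.IsHomogeneous d) (i : ℕ) (j : ℤ)
    (v) (hv : v ∈ freePart K n (F.coneShift d (i + 1)) j) :
    F.coneD f i v ∈ freePart K n (F.coneShift d i) j := by
  obtain ⟨x, y, rfl⟩ := exists_eq_append v
  obtain ⟨hx, hy⟩ := append_mem_freePart.mp hv
  rw [mem_freePart_add] at hy
  have h := Submodule.add_mem _ (F.d_mem _ _ _ hx) (smul_mem_freePart hf hy)
  cases i with
  | zero =>
    rw [coneD_zero_append]
    exact h
  | succ i =>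
    rw [coneD_succ_append]
    exact append_mem_freePart.mpr
      ⟨h, mem_freePart_add.mpr (Submodule.neg_mem _ (F.d_mem _ _ _ hy))⟩

theorem constantCoeff_coneD {f : MvPolynomial (Fin n) K} (hf : constantCoeff f = 0)
    (hF : F.IsMinimal) (i : ℕ) (v k) : constantCoeff (F.coneD f i v k) = 0 := by
  obtain ⟨x, y, rfl⟩ := exists_eq_append v
  cases i with
  | zero =>
    rw [coneD_zero_append]
    refine (map_add constantCoeff (F.d 0 x k) (f * y k)).trans ?_
    rw [hF 0 x k, map_mul, hf, zero_mul, zero_add]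
  | succ i =>
    rw [coneD_succ_append]
    refine Fin.addCases (fun k => ?_) (fun k => ?_) k
    · simp [hF (i + 1) x k, hf]
    · simp [hF i y k]

/-- The mapping cone of `f : F(-d) → F` is a graded free resolution of `R / (I, f)` when `f` is
a nonzerodivisor on `R / I`. -/
noncomputable def cone {f : MvPolynomial (Fin n) K} {d : ℕ} (hf : f.IsHomogeneous d)
    (hreg : IsSMulRegular (MvPolynomial (Fin n) K ⧸ I) f) :
    GradedFreeResolution (n := n) (MvPolynomial (Fin n) K ⧸ (I ⊔ Ideal.span {f}))
      (quotientPart (I ⊔ Ideal.span {f})) where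
  length := F.length + 1
  rank := coneRank F.rank
  rank_eq_zero i hi := by
    obtain ⟨i, rfl⟩ : ∃ k, i = k + 1 := ⟨i - 1, by omega⟩
    simp only [coneRank]
    rw [F.rank_eq_zero _ (by omega), F.rank_eq_zero _ (by omega)]
  shift := F.coneShift d
  d := F.coneD f
  ε := F.coneε f
  d_mem := F.coneD_mem hf
  ε_mem j v hv := by
    obtain ⟨p, hp, hpv⟩ := F.ε_mem j v hv
    exact ⟨p, hp, (F.coneε_eq_mk hpv).symm⟩
  ε_surjective := (Submodule.factor_surjective (le_sup_left : I ≤ I ⊔ Ideal.span {f})).comp F.ε_surjective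
  exact_zero := F.exact_coneD_coneε f
  exact_succ := F.exact_coneD_coneD hreg

/-! ### Minimality and maximal shifts of the cone -/

variable {F} {f : MvPolynomial (Fin n) K} {d : ℕ} (hf : f.IsHomogeneous d)
  (hreg : IsSMulRegular (MvPolynomial (Fin n) K ⧸ I) f)

theorem IsMinimal.cone (hF : F.IsMinimal) (hd : 0 < d) : (F.cone hf hreg).IsMinimal :=
  F.constantCoeff_coneD (constantCoeff_eq_zero_of_isHomogeneous hf hd) hF

theorem maxShift_cone_zero : (F.cone hf hreg).maxShift 0 = F.maxShift 0 := rfl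

theorem maxShift_cone_succ (i : ℕ) :
    (F.cone hf hreg).maxShift (i + 1) = F.maxShift (i + 1) ⊔ (F.maxShift i + d) := by
  have h : (F.cone hf hreg).maxShift (i + 1) =
      Finset.univ.sup fun k : Fin (F.rank (i + 1) + F.rank i) =>
        ((Fin.append (F.shift (i + 1)) (fun k => F.shift i k + (d : ℤ)) k : ℤ) : WithBot ℤ) := rfl
  rw [h]
  apply le_antisymm
  · refine Finset.sup_le fun k _ => ?_
    refine Fin.addCases (fun k => ?_) (fun k => ?_) k
    · rw [Fin.append_left]
      exact le_sup_of_le_left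
        (Finset.le_sup (f := fun k => (F.shift (i + 1) k : WithBot ℤ)) (Finset.mem_univ k))
    · rw [Fin.append_right]
      refine le_sup_of_le_right ?_
      have := Finset.le_sup (f := fun k => (F.shift i k : WithBot ℤ)) (Finset.mem_univ k)
      push_cast
      exact add_le_add_left this _
  · refine sup_le (Finset.sup_le fun k _ => ?_) ?_
    · refine le_trans (le_of_eq ?_) (Finset.le_sup (Finset.mem_univ (Fin.castAdd _ k)))
      rw [Fin.append_left]
    · by_cases he : F.maxShift i = ⊥
      · simp [he]
      · have hne : (Finset.univ : Finset (Fin (F.rank i))).Nonempty := by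
          by_contra hc
          rw [Finset.not_nonempty_iff_eq_empty] at hc
          exact he (by rw [maxShift, hc, Finset.sup_empty])
        obtain ⟨k, -, hk⟩ := Finset.exists_mem_eq_sup _ hne fun k => (F.shift i k : WithBot ℤ)
        refine le_trans (le_of_eq ?_) (Finset.le_sup (Finset.mem_univ (Fin.natAdd _ k)))
        rw [Fin.append_right, maxShift, hk]
        push_cast
        rfl

theorem maxShift_le_maxShift_cone (i : ℕ) : F.maxShift i ≤ (F.cone hf hreg).maxShift i := by
  cases i with
  | zero => exact (maxShift_cone_zero hf hreg).ge
  | succ i => exact (maxShift_cone_succ hf hreg i).symm ▸ le_sup_left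

theorem maxShift_eq_bot {i : ℕ} (hi : F.length < i) : F.maxShift i = ⊥ := by
  have : IsEmpty (Fin (F.rank i)) := by
    rw [F.rank_eq_zero i hi]
    infer_instance
  rw [maxShift, Finset.univ_eq_empty, Finset.sup_empty]

theorem Subadditive.cone (hF : F.Subadditive) : (F.cone hf hreg).Subadditive := by
  have h1 (a b : ℕ) : F.maxShift (a + b) ≤
      (F.cone hf hreg).maxShift a + (F.cone hf hreg).maxShift b := by
    rcases le_or_gt (a + b) F.length with h | h
    · exact (hF a b h).trans (add_le_add (maxShift_le_maxShift_cone hf hreg a)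
        (maxShift_le_maxShift_cone hf hreg b))
    -- The cone is one step longer than `F`, so `a + b` may exceed `F.length`.
    · exact (maxShift_eq_bot h).le.trans bot_le
  have h2 (a b : ℕ) (h : a + b ≤ F.length) : F.maxShift (a + b) + d ≤
      (F.cone hf hreg).maxShift (a + 1) + (F.cone hf hreg).maxShift b := by
    have := add_le_add_left (hF a b h) (d : WithBot ℤ)
    rw [add_right_comm] at this
    exact this.trans (add_le_add ((maxShift_cone_succ hf hreg a).symm ▸ le_sup_right)
      (maxShift_le_maxShift_cone hf hreg b))
  intro a b h
  have h' : a + b ≤ F.length + 1 := h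
  -- The `+ d` block of the cone sits at index `a + b - 1`, so one positive index must be lowered:
  -- `a` if possible, otherwise `b`.
  rcases a with _ | a
  · rcases b with _ | b
    · exact h1 0 0
    · have := h2 b 0 (by omega)
      rw [← add_assoc, maxShift_cone_succ]
      refine sup_le (h1 0 (b + 1)) ?_
      rwa [zero_add, add_comm (maxShift _ 0)]
  · rw [add_right_comm, maxShift_cone_succ]
    refine sup_le ?_ (h2 a b (by omega))
    rw [add_right_comm]
    exact h1 (a + 1) b

end Cone

end GradedFreeResolution

/-! ### Passage to ideals and regular sequences -/

variable {K : Type*} [Field K] {n : ℕ}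

theorem subadditivityHolds_bot :
    SubadditivityHolds (⊥ : Ideal (MvPolynomial (Fin n) K)) :=
  ⟨.ofBot, GradedFreeResolution.ofBot_isMinimal, GradedFreeResolution.ofBot_subadditive⟩

theorem SubadditivityHolds.sup_span_singleton {I : Ideal (MvPolynomial (Fin n) K)}
    (hI : SubadditivityHolds I) {f : MvPolynomial (Fin n) K} {d : ℕ} (hf : f.IsHomogeneous d)
    (hd : 0 < d) (hreg : IsSMulRegular (MvPolynomial (Fin n) K ⧸ I) f) :
    SubadditivityHolds (I ⊔ Ideal.span {f}) := by
  obtain ⟨F, hmin, hsub⟩ := hI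
  exact ⟨F.cone hf hreg, hmin.cone hf hreg hd, hsub.cone hf hreg⟩

theorem isSMulRegular_quotient_of_colon_eq {R : Type*} [CommRing R] {I : Ideal R} {f : R}
    (h : I.colon {f} = I) : IsSMulRegular (R ⧸ I) f := by
  rw [isSMulRegular_iff_right_eq_zero_of_smul]
  intro x hx
  obtain ⟨x, rfl⟩ := Submodule.mkQ_surjective I x
  rw [← map_smul] at hx
  refine (Submodule.Quotient.mk_eq_zero _).mpr ?_
  have hx' : f • x ∈ I := (Submodule.Quotient.mk_eq_zero _).mp hx
  rw [← h, Submodule.mem_colon_singleton]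
  rwa [smul_eq_mul, mul_comm] at hx'

/-- A nonunit of degree `0` is the constant `0`, which is homogeneous of every degree. This supplies
the positive degrees that minimality of the cone requires. -/
theorem exists_pos_isHomogeneous {f : MvPolynomial (Fin n) K} {e : ℕ} (hf : f.IsHomogeneous e)
    (hu : ¬ IsUnit f) : ∃ d, 0 < d ∧ f.IsHomogeneous d := by
  rcases Nat.eq_zero_or_pos e with rfl | he
  · refine ⟨1, one_pos, ?_⟩
    have hC : f = C (coeff 0 f) :=
      totalDegree_eq_zero_iff_eq_C.mp (Nat.le_zero.mp hf.totalDegree_le)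
    have h0 : coeff 0 f = 0 := by
      by_contra hc
      exact hu (hC ▸ (isUnit_iff_ne_zero.mpr hc).map C)
    rw [hC, h0, map_zero]
    exact isHomogeneous_zero _ _ _
  · exact ⟨e, he, hf⟩

open RingTheory.Sequence in
theorem subadditivityHolds_ofList (rs : List (MvPolynomial (Fin n) K))
    (hrs : ∀ g ∈ rs, ∃ d : ℕ, 0 < d ∧ g.IsHomogeneous d)
    (hreg : IsWeaklyRegular (MvPolynomial (Fin n) K) rs) :
    SubadditivityHolds (Ideal.ofList rs) := by
  -- Each element is regular modulo its predecessors, so the cone step adjoins the last one.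
  induction rs using List.reverseRecOn with
  | nil =>
    rw [Ideal.ofList_nil]
    exact subadditivityHolds_bot
  | append_singleton rs f ih =>
    rw [isWeaklyRegular_append_iff, isWeaklyRegular_singleton_iff] at hreg
    obtain ⟨d, hd, hf⟩ := hrs f (by simp)
    rw [Ideal.ofList_append, Ideal.ofList_singleton]
    refine (ih (fun g hg => hrs g (by simp [hg])) hreg.1).sup_span_singleton hf hd ?_
    have h := hreg.2
    rwa [smul_eq_mul, Ideal.mul_top] at h

end GradedRes

theorem mainTheorem9 {K : Type*} [Field K] (n : ℕ) :
    (∀ (I : Ideal (MvPolynomial (Fin n) K)) (f : MvPolynomial (Fin n) K) (d : ℕ),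
      I.IsHomogeneous (MvPolynomial.homogeneousSubmodule (Fin n) K) →
      f.IsHomogeneous d → 0 < d → I.colon {f} = I →
      GradedRes.SubadditivityHolds I →
      GradedRes.SubadditivityHolds (I ⊔ Ideal.span {f})) ∧
    (∀ I : Ideal (MvPolynomial (Fin n) K),
      GradedRes.IsHomogeneousCompleteIntersection I → GradedRes.SubadditivityHolds I) := by
  refine ⟨fun I f d _ hf hd hcolon hI =>
    hI.sup_span_singleton hf hd (GradedRes.isSMulRegular_quotient_of_colon_eq hcolon), ?_⟩
  rintro I ⟨rs, hhom, hreg, rfl⟩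
  refine GradedRes.subadditivityHolds_ofList rs (fun g hg => ?_) hreg.toIsWeaklyRegular
  obtain ⟨e, he⟩ := hhom g hg
  -- A regular sequence generates a proper ideal, so none of its members is a unit.
  refine GradedRes.exists_pos_isHomogeneous he fun hu => hreg.top_ne_smul ?_
  rw [Ideal.eq_top_of_isUnit_mem (Ideal.ofList rs) (Ideal.subset_span hg) hu, smul_eq_mul,
    Ideal.mul_top]
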